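/- Let $n$ be a non-negative integer, let $K$ be a field, and write $K[[x]]=K[[x_1,\dots,x_n]]$ for the algebra of commutative formal power series. For $f\neq g$ in $K[[x]]$ put $\delta(f,g)=2^{-\operatorname{val}(f-g)}$, where $\operatorname{val}(h)$ is the smallest total degree of a monomial occurring in $h$ with non-zero coefficient, and put $\delta(f,f)=0$; let $\tau$ be the topology induced by the metric $\delta$ (the $(x)$-adic topology). Let $<$ be a monomial order (a well-order on monomials such that $m_1<m_2$ implies $m_1m_3<m_2m_3$) that is compatible with the degree: $\deg m_1<\deg m_2$ implies $m_1<m_2$. For $0\neq f\in K[[x]]$, let $\operatorname{lm}(f)$ be the smallest monomial for $<$ that occurs in $f$, let $\operatorname{lc}(f)$ be its coefficient in $f$, and let $\operatorname{rem}(f)=\operatorname{lc}(f)\operatorname{lm}(f)-f$. Let $G\subseteq K[[x]]$ be any subset, and let $\to$ be the relation on $K[[x]]$ consisting of the steps $$\lambda\, m\operatorname{lm}(s)+S\;\to\;\frac{\lambda}{\operatorname{lc}(s)}\, m\operatorname{rem}(s)+S,$$ where $\lambda\in K\setminus\{0\}$, $m$ is a monomial, $s\in G$ is non-zero, and $S\in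 K[[x]]$ is a series in which the monomial $m\operatorname{lm}(s)$ does not occur. Let $\to^{*}$ be the reflexive transitive closure of $\to$, and let $\dashrightarrow$ be the closure of $\to^{*}$ in $K[[x]]\times K[[x]]$ for the product of the discrete topology on the first factor and $\tau$ on the second; that is, $a\dashrightarrow b$ if and only if every $\tau$-neighbourhood of $b$ contains some $b'$ with $a\to^{*}b'$. Then the following two properties are equivalent: 1. ($\tau$-confluence) for all $a,b,c\in K[[x]]$ with $a\to^{*}b$ and $a\to^{*}c$ there is $d\in K[[x]]$ with $b\dashrightarrow d$ and $c\dashrightarrow d$; 2. (infinitary confluence) for all $a,b,c\in K[[x]]$ with $a\dashrightarrow b$ and $a\dashrightarrow c$ there is $d\in K[[x]]$ with $b\dashrightarrow d$ and $c\dashrightarrow d$. -/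

import Mathlib

/-! ### Topological rewriting systems and their confluence properties -/

namespace TopRewriting

/-- `a ⇢ b`: the pair `(a, b)` lies in the closure of the reflexive transitive closure of `r`,
for the product of the discrete topology (on the first factor) and of `τ` (on the second). -/
def TopRew {A : Type*} (τ : TopologicalSpace A) (r : A → A → Prop) (a b : A) : Prop :=
  (a, b) ∈ @closure (A × A) (@instTopologicalSpaceProd A A ⊥ τ)
    {p : A × A | Relation.ReflTransGen r p.1 p.2}

/-- `τ`-confluence: finite rewriting sequences out of `a` are joined by `⇢`. -/
def IsTopConfluent {A : Type*} (τ : TopologicalSpace A) (r : A → A → Prop) : Prop :=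
  ∀ a b c : A, Relation.ReflTransGen r a b → Relation.ReflTransGen r a c →
    ∃ d : A, TopRew τ r b d ∧ TopRew τ r c d

/-- Infinitary confluence: `⇢`-related elements out of `a` are joined by `⇢`. -/
def IsInfinitaryConfluent {A : Type*} (τ : TopologicalSpace A) (r : A → A → Prop) : Prop :=
  ∀ a b c : A, TopRew τ r a b → TopRew τ r a c →
    ∃ d : A, TopRew τ r b d ∧ TopRew τ r c d

end TopRewriting

/-! ### Formal power series: metric, leading terms and rewriting steps -/

namespace PowerSeriesRewriting

/-- The distance `δ(f, g) = 2 ^ (-val (f - g))`, and `δ(f, f) = 0`; here `MvPowerSeries.order` is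
the least total degree of a monomial with non-zero coefficient. -/
noncomputable def adicDist {n : ℕ} {K : Type*} [Field K] (f g : MvPowerSeries (Fin n) K) : ℝ :=
  open Classical in if f = g then 0 else 1 / 2 ^ (f - g).order.toNat

theorem adicDist_nonneg {n : ℕ} {K : Type*} [Field K] (f g : MvPowerSeries (Fin n) K) :
    0 ≤ adicDist f g := by
  unfold adicDist
  split_ifs <;> positivity

theorem adicDist_self {n : ℕ} {K : Type*} [Field K] (f : MvPowerSeries (Fin n) K) :
    adicDist f f = 0 := by
  simp [adicDist]

theorem adicDist_comm {n : ℕ} {K : Type*} [Field K] (f g : MvPowerSeries (Fin n) K) :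
    adicDist f g = adicDist g f := by
  unfold adicDist
  rw [← neg_sub g f, MvPowerSeries.order_neg]
  by_cases h : f = g
  · rw [if_pos h, if_pos h.symm]
  · rw [if_neg h, if_neg (Ne.symm h)]

theorem eq_of_adicDist_eq_zero {n : ℕ} {K : Type*} [Field K] {f g : MvPowerSeries (Fin n) K}
    (h : adicDist f g = 0) : f = g := by
  by_contra hne
  have : 0 < adicDist f g := by
    unfold adicDist
    rw [if_neg hne]
    positivity
  exact this.ne' h

theorem adicDist_ultrametric {n : ℕ} {K : Type*} [Field K] (f g h : MvPowerSeries (Fin n) K) :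
    adicDist f h ≤ max (adicDist f g) (adicDist g h) := by
  by_cases hfg : f = g
  · subst hfg; exact le_max_right _ _
  by_cases hgh : g = h
  · subst hgh; exact le_max_left _ _
  by_cases hfh : f = h
  · subst hfh
    rw [adicDist_self]
    exact le_max_of_le_left (adicDist_nonneg _ _)
  have key : min (f - g).order (g - h).order ≤ (f - h).order := by
    have := MvPowerSeries.min_order_le_add (f := f - g) (g := g - h)
    rwa [sub_add_sub_cancel] at this
  have e1 := MvPowerSeries.ne_zero_iff_order_finite.1 (sub_ne_zero.2 hfg)
  have e2 := MvPowerSeries.ne_zero_iff_order_finite.1 (sub_ne_zero.2 hgh)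
  have e3 := MvPowerSeries.ne_zero_iff_order_finite.1 (sub_ne_zero.2 hfh)
  unfold adicDist
  rw [if_neg hfg, if_neg hgh, if_neg hfh, le_max_iff]
  rw [← e1, ← e2, ← e3] at key
  rcases min_le_iff.1 key with h1 | h1
  · left
    exact one_div_le_one_div_of_le (by positivity)
      (pow_le_pow_right₀ (by norm_num) (by exact_mod_cast h1))
  · right
    exact one_div_le_one_div_of_le (by positivity)
      (pow_le_pow_right₀ (by norm_num) (by exact_mod_cast h1))

/-- The metric space structure on `K[[x₁, …, xₙ]]` given by `δ`. -/
@[reducible] noncomputable def adicMetricSpace (n : ℕ) (K : Type*) [Field K] :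
    MetricSpace (MvPowerSeries (Fin n) K) where
  dist := adicDist
  dist_self := adicDist_self
  dist_comm := adicDist_comm
  dist_triangle f g h := (adicDist_ultrametric f g h).trans
    (max_le_add_of_nonneg (adicDist_nonneg _ _) (adicDist_nonneg _ _))
  eq_of_dist_eq_zero := eq_of_adicDist_eq_zero

/-- The `(x₁, …, xₙ)`-adic topology on `K[[x₁, …, xₙ]]`, induced by the metric `δ`. -/
@[reducible] noncomputable def adicTopology (n : ℕ) (K : Type*) [Field K] :
    TopologicalSpace (MvPowerSeries (Fin n) K) :=
  (adicMetricSpace n K).toUniformSpace.toTopologicalSpace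

/-- The monomial order is compatible with the degree: monomials of smaller degree are smaller. -/
def DegreeCompatible {n : ℕ} (ord : MonomialOrder (Fin n)) : Prop :=
  ∀ a b : Fin n →₀ ℕ, a.degree < b.degree → ord.toSyn a < ord.toSyn b

/-- The set of (exponents of) monomials occurring in `f`. -/
def supp {n : ℕ} {K : Type*} [Field K] (f : MvPowerSeries (Fin n) K) : Set (Fin n →₀ ℕ) :=
  {m | MvPowerSeries.coeff m f ≠ 0}

/-- The (exponent of the) leading monomial of `f ≠ 0`: the smallest monomial of the support for
the monomial order, i.e. the greatest one for the opposite order. By convention it is `0` if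
`f = 0`. -/
noncomputable def lm {n : ℕ} {K : Type*} [Field K] (ord : MonomialOrder (Fin n))
    (f : MvPowerSeries (Fin n) K) : Fin n →₀ ℕ :=
  open Classical in
  if h : (supp f).Nonempty then Function.argminOn ord.toSyn (supp f) h else 0

/-- The leading coefficient. -/
noncomputable def lc {n : ℕ} {K : Type*} [Field K] (ord : MonomialOrder (Fin n))
    (f : MvPowerSeries (Fin n) K) : K :=
  MvPowerSeries.coeff (lm ord f) f

/-- The remainder `rem f = lc f • lm f - f`. -/
noncomputable def remainder {n : ℕ} {K : Type*} [Field K] (ord : MonomialOrder (Fin n))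
    (f : MvPowerSeries (Fin n) K) : MvPowerSeries (Fin n) K :=
  MvPowerSeries.monomial (lm ord f) (lc ord f) - f

/-- The rewriting relation induced by `G` and the monomial order:
`c (m lm(s)) + S → (c / lc(s)) (m rem(s)) + S`, for a scalar `c ≠ 0`, a monomial `m`, a non-zero
`s ∈ G` and a series `S` in which the monomial `m lm(s)` does not occur. -/
def Step {n : ℕ} {K : Type*} [Field K] (ord : MonomialOrder (Fin n))
    (G : Set (MvPowerSeries (Fin n) K)) (f g : MvPowerSeries (Fin n) K) : Prop :=
  ∃ (c : K) (m : Fin n →₀ ℕ) (s S : MvPowerSeries (Fin n) K),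
    c ≠ 0 ∧ s ∈ G ∧ s ≠ 0 ∧ m + lm ord s ∉ supp S ∧
    f = MvPowerSeries.monomial (m + lm ord s) c + S ∧
    g = (c / lc ord s) • (MvPowerSeries.monomial m 1 * remainder ord s) + S

end PowerSeriesRewriting

namespace PowerSeriesRewriting

open Relation TopRewriting

variable {n : ℕ} {K : Type*} [Field K]

/-! Everything is tested modulo terms of degree at least `d`, for each `d`. Since the order refines
the degree, eliminating a monomial of degree at least `d` leaves the coefficients below degree `d`
untouched, so finite rewriting passes to truncations (`AgreeBelow.exists_reflTransGen`). Only
finitely many monomials have degree below `d`, so finitely many steps remove all reducible ones;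
letting `d` grow yields a limit normal form of any series (`exists_normal`). Given `a ⇢ b` and `a ⇢
c`, take normal forms `N` of `b` and `N'` of `c`. Up to degree `d`, both are reached from `a` by
finite rewriting, and `τ`-confluence joins these approximations. Being irreducible below `d`, they
cannot change there, so `N` and `N'` agree below every `d`. The converse holds because `→*` is
contained in `⇢`. -/

/-- `f` and `g` have the same coefficients in all degrees `< d`. -/
def AgreeBelow (d : ℕ) (f g : MvPowerSeries (Fin n) K) : Prop :=
  ∀ m : Fin n →₀ ℕ, m.degree < d → MvPowerSeries.coeff m f = MvPowerSeries.coeff m g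

theorem AgreeBelow.symm {d : ℕ} {f g : MvPowerSeries (Fin n) K} (h : AgreeBelow d f g) :
    AgreeBelow d g f := fun m hm => (h m hm).symm

theorem AgreeBelow.trans {d : ℕ} {f g h : MvPowerSeries (Fin n) K} (h₁ : AgreeBelow d f g)
    (h₂ : AgreeBelow d g h) : AgreeBelow d f h := fun m hm => (h₁ m hm).trans (h₂ m hm)

theorem agreeBelow_of_adicDist_lt {d : ℕ} {f g : MvPowerSeries (Fin n) K}
    (h : adicDist f g < 1 / 2 ^ d) : AgreeBelow d f g := by
  intro m hm
  by_cases hfg : f = g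
  · rw [hfg]
  unfold adicDist at h
  rw [if_neg hfg, one_div_lt_one_div (by positivity) (by positivity),
    pow_lt_pow_iff_right₀ (by norm_num)] at h
  have e := MvPowerSeries.ne_zero_iff_order_finite.1 (sub_ne_zero.2 hfg)
  rw [← sub_eq_zero, ← map_sub]
  apply MvPowerSeries.coeff_of_lt_order
  rw [← e]
  exact_mod_cast hm.trans h

theorem AgreeBelow.adicDist_le {d : ℕ} {f g : MvPowerSeries (Fin n) K}
    (h : AgreeBelow d f g) : adicDist f g ≤ 1 / 2 ^ d := by
  unfold adicDist
  split_ifs with hfg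
  · positivity
  have e := MvPowerSeries.ne_zero_iff_order_finite.1 (sub_ne_zero.2 hfg)
  have key : (d : ℕ∞) ≤ (f - g).order := by
    apply MvPowerSeries.le_order
    intro m hm
    rw [map_sub, sub_eq_zero]
    exact h m (by exact_mod_cast hm)
  rw [← e] at key
  exact one_div_le_one_div_of_le (by positivity)
    (pow_le_pow_right₀ (by norm_num) (by exact_mod_cast key))

/-- The discrete first factor fixes the source `a`, so only the target is approximated, by balls of
radius `2 ^ (-d)`. -/
theorem topRew_iff {r : MvPowerSeries (Fin n) K → MvPowerSeries (Fin n) K → Prop}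
    {a b : MvPowerSeries (Fin n) K} :
    TopRew (adicTopology n K) r a b ↔ ∀ d, ∃ b', ReflTransGen r a b' ∧ AgreeBelow d b' b := by
  let := adicMetricSpace n K
  constructor
  · intro h d
    have hopen : @IsOpen _ (@instTopologicalSpaceProd _ _ ⊥ (adicTopology n K))
        (({a} : Set (MvPowerSeries (Fin n) K)) ×ˢ Metric.ball b (1 / 2 ^ d)) :=
      @IsOpen.prod _ _ ⊥ (adicTopology n K) _ _ trivial Metric.isOpen_ball
    obtain ⟨⟨x, y⟩, ⟨hx, hy⟩, hr⟩ := (@mem_closure_iff _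
      (@instTopologicalSpaceProd _ _ ⊥ (adicTopology n K)) _ _).1 h _ hopen
      ⟨rfl, Metric.mem_ball_self (by positivity)⟩
    obtain rfl : x = a := hx
    exact ⟨y, hr, agreeBelow_of_adicDist_lt hy⟩
  · intro h
    refine (@mem_closure_iff _
      (@instTopologicalSpaceProd _ _ ⊥ (adicTopology n K)) _ _).2 fun o ho hab => ?_
    obtain ⟨u, v, -, hv, ha, hb, huv⟩ := (@isOpen_prod_iff _ _ ⊥ (adicTopology n K) _).1 ho a b hab
    obtain ⟨ε, hε, hball⟩ := Metric.isOpen_iff.1 hv b hb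
    obtain ⟨d, hd⟩ := exists_pow_lt_of_lt_one hε (by norm_num : (1 / 2 : ℝ) < 1)
    obtain ⟨b', hr, hag⟩ := h d
    refine ⟨(a, b'), huv ⟨ha, hball ?_⟩, hr⟩
    refine lt_of_le_of_lt (hag.adicDist_le) ?_
    rwa [one_div_pow] at hd

variable {ord : MonomialOrder (Fin n)} {G : Set (MvPowerSeries (Fin n) K)}

theorem supp_nonempty {s : MvPowerSeries (Fin n) K} (hs : s ≠ 0) : (supp s).Nonempty := by
  by_contra h
  refine hs (MvPowerSeries.ext fun m => ?_)
  by_contra hm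
  exact h ⟨m, hm⟩

theorem lc_ne_zero {s : MvPowerSeries (Fin n) K} (hs : s ≠ 0) : lc ord s ≠ 0 := by
  unfold lc lm
  rw [dif_pos (supp_nonempty hs)]
  exact Function.argminOn_mem ord.toSyn (supp s) (supp_nonempty hs)

theorem coeff_eq_zero_of_lt_lm {s : MvPowerSeries (Fin n) K} {u : Fin n →₀ ℕ}
    (hu : ord.toSyn u < ord.toSyn (lm ord s)) : MvPowerSeries.coeff u s = 0 := by
  by_contra h
  unfold lm at hu
  rw [dif_pos ⟨u, h⟩] at hu
  exact Function.not_lt_argminOn ord.toSyn (supp s) h hu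

/-- The result of eliminating the monomial `m * lm s` from `f` by means of `s`. -/
noncomputable def reduce (ord : MonomialOrder (Fin n)) (m : Fin n →₀ ℕ)
    (s f : MvPowerSeries (Fin n) K) : MvPowerSeries (Fin n) K :=
  f - MvPowerSeries.monomial m (MvPowerSeries.coeff (m + lm ord s) f / lc ord s) * s

theorem coeff_reduce_self {s : MvPowerSeries (Fin n) K} (hs : s ≠ 0) (m : Fin n →₀ ℕ)
    (f : MvPowerSeries (Fin n) K) :
    MvPowerSeries.coeff (m + lm ord s) (reduce ord m s f) = 0 := by
  rw [reduce, map_sub, MvPowerSeries.coeff_add_monomial_mul]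
  change _ - _ / _ * lc ord s = 0
  rw [div_mul_cancel₀ _ (lc_ne_zero hs), sub_self]

/-- The order is compatible with multiplication, so every monomial of `m * s` is at least `m * lm
s`. -/
theorem coeff_reduce_of_lt {s : MvPowerSeries (Fin n) K} {m u : Fin n →₀ ℕ}
    (hu : ord.toSyn u < ord.toSyn (m + lm ord s)) (f : MvPowerSeries (Fin n) K) :
    MvPowerSeries.coeff u (reduce ord m s f) = MvPowerSeries.coeff u f := by
  classical
  rw [reduce, map_sub, MvPowerSeries.coeff_monomial_mul]
  split_ifs with h
  · rw [coeff_eq_zero_of_lt_lm (ord := ord) (s := s) (u := u - m), mul_zero, sub_zero]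
    rw [← add_tsub_cancel_of_le h, map_add, map_add] at hu
    exact lt_of_add_lt_add_left hu
  · rw [sub_zero]

theorem reduce_eq (m : Fin n →₀ ℕ) {s : MvPowerSeries (Fin n) K} (hs : s ≠ 0) (c : K)
    (S : MvPowerSeries (Fin n) K) (hS : MvPowerSeries.coeff (m + lm ord s) S = 0) :
    reduce ord m s (MvPowerSeries.monomial (m + lm ord s) c + S) =
      (c / lc ord s) • (MvPowerSeries.monomial m 1 * remainder ord s) + S := by
  classical
  have h1 : MvPowerSeries.coeff (m + lm ord s)
      (MvPowerSeries.monomial (m + lm ord s) c + S) = c := by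
    rw [map_add, hS, add_zero, MvPowerSeries.coeff_monomial_same]
  have h2 : (c / lc ord s) • (MvPowerSeries.monomial m (1 : K) *
      MvPowerSeries.monomial (lm ord s) (lc ord s)) =
      MvPowerSeries.monomial (m + lm ord s) c := by
    rw [MvPowerSeries.monomial_mul_monomial, ← map_smul, smul_eq_mul, one_mul,
      div_mul_cancel₀ _ (lc_ne_zero hs)]
  have h3 : MvPowerSeries.monomial m (c / lc ord s) =
      (c / lc ord s) • MvPowerSeries.monomial m (1 : K) := by
    rw [← map_smul, smul_eq_mul, mul_one]
  rw [reduce, h1, remainder, mul_sub, smul_sub, h2, h3, smul_mul_assoc]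
  abel

/-- The series `S` of a step is forced: it is `f` without its term at `m * lm s`. A step is thus a
subtraction of a multiple of `s`. -/
theorem step_iff {f g : MvPowerSeries (Fin n) K} :
    Step ord G f g ↔ ∃ m, ∃ s ∈ G, s ≠ 0 ∧ MvPowerSeries.coeff (m + lm ord s) f ≠ 0 ∧
      g = reduce ord m s f := by
  classical
  constructor
  · rintro ⟨c, m, s, S, hc, hsG, hs, hS, rfl, rfl⟩
    have hS' : MvPowerSeries.coeff (m + lm ord s) S = 0 := not_not.1 hS
    refine ⟨m, s, hsG, hs, ?_, (reduce_eq m hs c S hS').symm⟩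
    rwa [map_add, hS', add_zero, MvPowerSeries.coeff_monomial_same]
  · rintro ⟨m, s, hsG, hs, hf, rfl⟩
    set c := MvPowerSeries.coeff (m + lm ord s) f with hc
    have hS : MvPowerSeries.coeff (m + lm ord s)
        (f - MvPowerSeries.monomial (m + lm ord s) c) = 0 := by
      rw [map_sub, MvPowerSeries.coeff_monomial_same, sub_self]
    refine ⟨c, m, s, f - MvPowerSeries.monomial (m + lm ord s) c, hf, hsG, hs,
      not_not.2 hS, (add_sub_cancel _ _).symm, ?_⟩
    rw [← reduce_eq m hs c _ hS, add_sub_cancel]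

theorem agreeBelow_reduce (hord : DegreeCompatible ord) {d : ℕ} {m : Fin n →₀ ℕ}
    {s : MvPowerSeries (Fin n) K} (hd : d ≤ (m + lm ord s).degree)
    (f : MvPowerSeries (Fin n) K) : AgreeBelow d (reduce ord m s f) f :=
  fun u hu => coeff_reduce_of_lt (hord u _ (hu.trans_le hd)) f

theorem AgreeBelow.reduce {d : ℕ} {f f' : MvPowerSeries (Fin n) K} (h : AgreeBelow d f f')
    {m : Fin n →₀ ℕ} {s : MvPowerSeries (Fin n) K} (hd : (m + lm ord s).degree < d) :
    AgreeBelow d (reduce ord m s f) (reduce ord m s f') := by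
  intro u hu
  rw [PowerSeriesRewriting.reduce, PowerSeriesRewriting.reduce, map_sub, map_sub, h u hu, h _ hd]

theorem AgreeBelow.exists_reflTransGen (hord : DegreeCompatible ord) {d : ℕ}
    {f f' g : MvPowerSeries (Fin n) K} (h : AgreeBelow d f f')
    (hfg : ReflTransGen (Step ord G) f g) :
    ∃ g', ReflTransGen (Step ord G) f' g' ∧ AgreeBelow d g g' := by
  induction hfg with
  | refl => exact ⟨f', .refl, h⟩
  | @tail b c _ hstep ih =>
    obtain ⟨b', hb', hag⟩ := ih
    obtain ⟨m, s, hsG, hs, hb, rfl⟩ := step_iff.1 hstep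
    -- A step at degree below `d` can be replayed, since the coefficient it uses is shared; any
    -- other step is invisible below `d` and is skipped.
    rcases lt_or_ge (m + lm ord s).degree d with hd | hd
    · refine ⟨_, hb'.tail (step_iff.2 ⟨m, s, hsG, hs, ?_, rfl⟩), hag.reduce hd⟩
      rwa [← hag _ hd]
    · exact ⟨b', hb', (agreeBelow_reduce hord hd b).trans hag⟩

/-- No monomial of `f` of degree `< d` is divisible by a leading monomial of `G`. -/
def NormalBelow (ord : MonomialOrder (Fin n)) (G : Set (MvPowerSeries (Fin n) K)) (d : ℕ)
    (f : MvPowerSeries (Fin n) K) : Prop :=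
  ∀ m, ∀ s ∈ G, s ≠ 0 → (m + lm ord s).degree < d → MvPowerSeries.coeff (m + lm ord s) f = 0

theorem NormalBelow.agreeBelow (hord : DegreeCompatible ord) {d : ℕ}
    {f g : MvPowerSeries (Fin n) K} (hf : NormalBelow ord G d f)
    (hfg : ReflTransGen (Step ord G) f g) : AgreeBelow d g f := by
  induction hfg with
  | refl => exact fun _ _ => rfl
  | @tail b c _ hstep ih =>
    obtain ⟨m, s, hsG, hs, hb, rfl⟩ := step_iff.1 hstep
    rcases lt_or_ge (m + lm ord s).degree d with hd | hd
    · exact absurd ((ih _ hd).trans (hf m s hsG hs hd)) hb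
    · exact (agreeBelow_reduce hord hd b).trans ih

theorem exists_reflTransGen_coeff_eq_zero (T : Finset (Fin n →₀ ℕ))
    (f : MvPowerSeries (Fin n) K) :
    ∃ g, ReflTransGen (Step ord G) f g ∧ ∀ m, ∀ s ∈ G, s ≠ 0 → m + lm ord s ∈ T →
      MvPowerSeries.coeff (m + lm ord s) g = 0 := by
  classical
  -- Monomials are cleared in increasing order: eliminating the largest one, `u`, cannot bring back
  -- the smaller ones already cleared.
  induction T using Finset.induction_on_max_value ord.toSyn with
  | empty => exact ⟨f, .refl, by simp⟩
  | insert u T huT hmax ih =>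
    obtain ⟨g, hfg, hg⟩ := ih
    by_cases hu : ∃ m, ∃ s ∈ G, s ≠ 0 ∧ m + lm ord s = u ∧ MvPowerSeries.coeff u g ≠ 0
    · obtain ⟨m, s, hsG, hs, rfl, hne⟩ := hu
      refine ⟨reduce ord m s g, hfg.tail (step_iff.2 ⟨m, s, hsG, hs, hne, rfl⟩), ?_⟩
      intro m' s' hsG' hs' hmem
      rcases Finset.mem_insert.1 hmem with h | h
      · rw [h, coeff_reduce_self hs]
      · rw [coeff_reduce_of_lt, hg m' s' hsG' hs' h]
        refine lt_of_le_of_ne (hmax _ h) fun he => huT ?_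
        rwa [← ord.toSyn.injective he]
    · refine ⟨g, hfg, fun m s hsG hs hmem => ?_⟩
      rcases Finset.mem_insert.1 hmem with h | h
      · by_contra hne
        exact hu ⟨m, s, hsG, hs, h, h ▸ hne⟩
      · exact hg m s hsG hs h

theorem exists_normalBelow (d : ℕ) (f : MvPowerSeries (Fin n) K) :
    ∃ g, ReflTransGen (Step ord G) f g ∧ NormalBelow ord G d g := by
  obtain ⟨g, hfg, hg⟩ := exists_reflTransGen_coeff_eq_zero (ord := ord) (G := G)
    (Finsupp.finite_of_degree_le (σ := Fin n) d).toFinset f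
  refine ⟨g, hfg, fun m s hsG hs hd => hg m s hsG hs ?_⟩
  rw [Set.Finite.mem_toFinset]
  exact hd.le

theorem exists_normal (hord : DegreeCompatible ord) (f : MvPowerSeries (Fin n) K) :
    ∃ N, TopRew (adicTopology n K) (Step ord G) f N ∧ ∀ d, NormalBelow ord G d N := by
  choose F hF hFn using fun d f => exists_normalBelow (ord := ord) (G := G) d f
  let g : ℕ → MvPowerSeries (Fin n) K := Nat.rec f fun d h => F (d + 1) h
  have hchain : ∀ i j, i ≤ j → ReflTransGen (Step ord G) (g i) (g j) := by
    intro i j hij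
    induction hij with
    | refl => exact .refl
    | step _ ih => exact ih.trans (hF _ _)
  have hnormal : ∀ d, NormalBelow ord G d (g d) := by
    rintro (_ | d)
    · intro m s _ _ hd
      exact absurd hd (Nat.not_lt_zero _)
    · exact hFn (d + 1) (g d)
  -- The coefficient at `m` is frozen from stage `m.degree + 1` on, because that stage is already
  -- normal in the degree of `m`.
  let N : MvPowerSeries (Fin n) K := fun m => MvPowerSeries.coeff m (g (m.degree + 1))
  have hN : ∀ d, AgreeBelow d (g d) N := fun d m hm =>
    (hnormal (m.degree + 1)).agreeBelow hord (hchain _ _ hm) m (Nat.lt_succ_self _)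
  refine ⟨N, topRew_iff.2 fun d => ⟨g d, hchain 0 d (Nat.zero_le d), hN d⟩, ?_⟩
  intro d m s hsG hs hd
  rw [← hN d _ hd]
  exact hnormal d m s hsG hs hd

theorem NormalBelow.congr {d : ℕ} {f g : MvPowerSeries (Fin n) K} (hf : NormalBelow ord G d f)
    (h : AgreeBelow d f g) : NormalBelow ord G d g :=
  fun m s hsG hs hd => (h _ hd).symm.trans (hf m s hsG hs hd)

/-- This is transitivity of `⇢`: a finite sequence out of `b` is replayed from an approximation of
`b` reachable from `a`. -/
theorem exists_reflTransGen_agreeBelow (hord : DegreeCompatible ord)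
    {a b N : MvPowerSeries (Fin n) K} (hab : TopRew (adicTopology n K) (Step ord G) a b)
    (hbN : TopRew (adicTopology n K) (Step ord G) b N) (d : ℕ) :
    ∃ b', ReflTransGen (Step ord G) a b' ∧ AgreeBelow d b' N := by
  obtain ⟨b₁, hab₁, hb₁⟩ := topRew_iff.1 hab d
  obtain ⟨b₂, hbb₂, hb₂⟩ := topRew_iff.1 hbN d
  obtain ⟨b₃, hb₁₃, hb₃⟩ := hb₁.symm.exists_reflTransGen hord hbb₂
  exact ⟨b₃, hab₁.trans hb₁₃, hb₃.symm.trans hb₂⟩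

theorem NormalBelow.agreeBelow_of_topRew (hord : DegreeCompatible ord) {d : ℕ}
    {f g : MvPowerSeries (Fin n) K} (hf : NormalBelow ord G d f)
    (hfg : TopRew (adicTopology n K) (Step ord G) f g) : AgreeBelow d f g := by
  obtain ⟨g', hfg', hg'⟩ := topRew_iff.1 hfg d
  exact (hf.agreeBelow hord hfg').symm.trans hg'

theorem topRew_of_reflTransGen {a b : MvPowerSeries (Fin n) K}
    (h : ReflTransGen (Step ord G) a b) : TopRew (adicTopology n K) (Step ord G) a b :=
  topRew_iff.2 fun _ => ⟨b, h, fun _ _ => rfl⟩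

end PowerSeriesRewriting

open PowerSeriesRewriting in
theorem mainTheorem2 {n : ℕ} {K : Type*} [Field K] (G : Set (MvPowerSeries (Fin n) K))
    (ord : MonomialOrder (Fin n)) (hord : PowerSeriesRewriting.DegreeCompatible ord) :
    TopRewriting.IsTopConfluent (PowerSeriesRewriting.adicTopology n K)
        (PowerSeriesRewriting.Step ord G) ↔
      TopRewriting.IsInfinitaryConfluent (PowerSeriesRewriting.adicTopology n K)
        (PowerSeriesRewriting.Step ord G) := by
  constructor
  · intro hconf a b c hab hac
    obtain ⟨N, hbN, hN⟩ := exists_normal hord b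
    obtain ⟨N', hcN', hN'⟩ := exists_normal hord c
    have heq : ∀ d, AgreeBelow d N N' := by
      intro d
      obtain ⟨b', hab', hb'⟩ := exists_reflTransGen_agreeBelow hord hab hbN d
      obtain ⟨c', hac', hc'⟩ := exists_reflTransGen_agreeBelow hord hac hcN' d
      obtain ⟨e, hbe, hce⟩ := hconf a b' c' hab' hac'
      -- `b'` inherits normality below `d` from `N`, so passing to `e` changes nothing there;
      -- likewise for `c'`.
      have h₁ := ((hN d).congr hb'.symm).agreeBelow_of_topRew hord hbe
      have h₂ := ((hN' d).congr hc'.symm).agreeBelow_of_topRew hord hce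
      exact hb'.symm.trans (h₁.trans (h₂.symm.trans hc'))
    obtain rfl : N = N' := MvPowerSeries.ext fun m => heq (m.degree + 1) m (Nat.lt_succ_self _)
    exact ⟨N, hbN, hcN'⟩
  · intro hconf a b c hab hac
    exact hconf a b c (topRew_of_reflTransGen hab) (topRew_of_reflTransGen hac)
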